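/- Let $\mathcal{A}$ denote the anticommutator spin algebra over $\mathbb{C}$, i.e. the unital associative $\mathbb{C}$-algebra with generators $x,y,z$ and relations $xy+yx=2z$, $yz+zy=2x$, $zx+xz=2y$. For an even integer $d\ge 0$, an $\mathcal{A}$-module has type $B(d)$ when it has a basis $\{v_i\}_{i=0}^d$ such that, for $0\le i\le d$, $$y.v_i=(d-i+1)v_{i-1}+(i+1)v_{i+1},\qquad x.v_i=(-1)^i(d-2i)v_i,\qquad z.v_i=(-1)^{i-1}(d-i+1)v_{i-1}+(-1)^i(i+1)v_{i+1},$$ where $v_{-1}=0=v_{d+1}$. Let $D\ge 0$ be an even integer and let $Q_D$ be the hypercube, with vertex set $\mathcal{X}=\{0,1\}^D$, two vertices being adjacent if and only if they differ in exactly one coordinate, and with path-length distance $\partial$. Let $V=\mathbb{C}^{\mathcal{X}}$ be the standard module, on which $\mathrm{Mat}_{\mathcal{X}}(\mathbb{C})$ acts by left multiplication, and let $A$ be the adjacency matrix. Order the eigenvalues of $A$ as $\theta_i=(-1)^i(D-2i)$ $(0\le i\le D)$ and let $F_i=\prod_{0\le j\le D,\,j\ne i}(A-\theta_jI)/(\theta_i-\theta_j)$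 be the primitive idempotent for $\theta_i$ (for $D=0$ put $F_1=0$). Fix a vertex $\mathbf{x}$. The dual adjacency matrix $B$ (with respect to $\mathbf{x}$ and this ordering) is the diagonal matrix with $(\mathbf{y},\mathbf{y})$-entry $|\mathcal{X}|\,(F_1)_{\mathbf{x}\mathbf{y}}$. For $0\le i\le D$ let $E_i^*$ be the diagonal matrix with $(\mathbf{y},\mathbf{y})$-entry $1$ if $\partial(\mathbf{x},\mathbf{y})=i$ and $0$ otherwise. The Terwilliger algebra $T=T(\mathbf{x})$ is the subalgebra of $\mathrm{Mat}_{\mathcal{X}}(\mathbb{C})$ generated by $A$ and $E_0^*,\dots,E_D^*$. A $T$-module is a subspace $W\subseteq V$ with $TW\subseteq W$; it is irreducible if $W\neq 0$ and $W$ contains no $T$-modules other than $0$ and $W$; its endpoint is then $\min\{i : E_i^*W\ne 0\}$. Then the following hold. (i) There is a unique $\mathcal{A}$-module structure on the vector space $V$ such that $x$ and $y$ act as $A$ and $B$, respectively. (ii) Let $W$ be an irreducible $T$-module with endpoint $r$. Then $2r\le D$, and, for the structure in (i), $W$ is an $\mathcal{A}$-submodule of $V$ that is an irreducible $\mathcal{A}$-module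 of type $B(D-2r)$. -/

import Mathlib

open scoped Matrix

noncomputable section

/-! The anticommutator spin algebra. -/

/-- The three generators of the anticommutator spin algebra. -/
inductive ACSAGen : Type
  | x | y | z

/-- The defining relations `xy + yx = 2z`, `yz + zy = 2x`, `zx + xz = 2y`,
imposed on the free algebra on `x, y, z`. -/
inductive ACSARel (K : Type*) [Field K] :
    FreeAlgebra K ACSAGen → FreeAlgebra K ACSAGen → Prop
  | xy : ACSARel K
      (FreeAlgebra.ι K .x * FreeAlgebra.ι K .y + FreeAlgebra.ι K .y * FreeAlgebra.ι K .x)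
      (2 * FreeAlgebra.ι K .z)
  | yz : ACSARel K
      (FreeAlgebra.ι K .y * FreeAlgebra.ι K .z + FreeAlgebra.ι K .z * FreeAlgebra.ι K .y)
      (2 * FreeAlgebra.ι K .x)
  | zx : ACSARel K
      (FreeAlgebra.ι K .z * FreeAlgebra.ι K .x + FreeAlgebra.ι K .x * FreeAlgebra.ι K .z)
      (2 * FreeAlgebra.ι K .y)

/-- The anticommutator spin algebra over `K`, by generators and relations. -/
abbrev ACSA (K : Type*) [Field K] : Type _ := RingQuot (ACSARel K)

/-- The image in the anticommutator spin algebra of a generator. -/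
def ACSA.gen (K : Type*) [Field K] (g : ACSAGen) : ACSA K :=
  RingQuot.mkAlgHom K (ACSARel K) (FreeAlgebra.ι K g)

/-- A module `M` over the anticommutator spin algebra has type `B(d)`: `d` is even and `M` has a
basis `v 0, …, v d` on which `x, y, z` act by the displayed formulas, with `v (-1) = 0` and
`v (d + 1) = 0`. -/
def ACSA.HasTypeB (K : Type*) [Field K] (d : ℕ) (M : Type*) [AddCommGroup M] [Module K M]
    [Module (ACSA K) M] [IsScalarTower K (ACSA K) M] : Prop :=
  Even d ∧ ∃ (b : Module.Basis (Fin (d + 1)) K M) (v : ℤ → M),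
    (∀ i : Fin (d + 1), v ((i : ℕ) : ℤ) = b i) ∧ v (-1) = 0 ∧ v ((d : ℤ) + 1) = 0 ∧
    ∀ i : ℤ, 0 ≤ i → i ≤ (d : ℤ) →
      ACSA.gen K .y • v i
          = ((d : K) - (i : K) + 1) • v (i - 1) + ((i : K) + 1) • v (i + 1) ∧
      ACSA.gen K .x • v i
          = ((-1 : K) ^ i * ((d : K) - 2 * (i : K))) • v i ∧
      ACSA.gen K .z • v i
          = ((-1 : K) ^ (i - 1) * ((d : K) - (i : K) + 1)) • v (i - 1)
            + ((-1 : K) ^ i * ((i : K) + 1)) • v (i + 1)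

/-! Matrices and algebras attached to a finite graph `G` with vertex set `X`. The matrices act on
the standard module `X → ℂ` by left multiplication. -/

section Graph

variable {X : Type*} [Fintype X] [DecidableEq X] (G : SimpleGraph X)

open scoped Classical in
/-- The adjacency matrix `A` of `G`, with complex entries. -/
def adjacency : Matrix X X ℂ := G.adjMatrix ℂ

/-- The Bose-Mesner algebra `M` of `G`: the algebra generated by the adjacency matrix. -/
def boseMesner : Subalgebra ℂ (Matrix X X ℂ) := Algebra.adjoin ℂ {adjacency G}

/-- The dual idempotent `E*_i` of `G` with respect to the vertex `p`. -/
def dualIdempotent (p : X) (i : ℕ) : Matrix X X ℂ :=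
  Matrix.diagonal fun q => if G.dist p q = i then 1 else 0

/-- The dual Bose-Mesner algebra `M*` of `G` with respect to `p`, as a space of matrices: the span
of the dual idempotents. -/
def dualBoseMesner (p : X) : Submodule ℂ (Matrix X X ℂ) :=
  Submodule.span ℂ (Set.range (dualIdempotent G p))

/-- The Terwilliger algebra `T` of `G` with respect to `p`: the algebra generated by `M`, `M*`. -/
def terwilliger (p : X) : Subalgebra ℂ (Matrix X X ℂ) :=
  Algebra.adjoin ℂ ((boseMesner G : Set (Matrix X X ℂ)) ∪ (dualBoseMesner G p : Set (Matrix X X ℂ)))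

/-- `W` is a `T`-module: a subspace of the standard module that is stable under `T`. -/
def IsTModule (p : X) (W : Submodule ℂ (X → ℂ)) : Prop :=
  ∀ N ∈ terwilliger G p, ∀ w ∈ W, N *ᵥ w ∈ W

/-- `W` is an irreducible `T`-module. -/
def IsIrreducibleTModule (p : X) (W : Submodule ℂ (X → ℂ)) : Prop :=
  IsTModule G p W ∧ W ≠ ⊥ ∧ ∀ U : Submodule ℂ (X → ℂ), IsTModule G p U → U ≤ W → U = ⊥ ∨ U = W

/-- `r` is the endpoint of `W`: the least `i` with `E*_i W ≠ 0`. -/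
def IsEndpoint (p : X) (W : Submodule ℂ (X → ℂ)) (r : ℕ) : Prop :=
  IsLeast {i : ℕ | ∃ w ∈ W, dualIdempotent G p i *ᵥ w ≠ 0} r

/-- For an ordering `θ 0, …, θ D` of the distinct eigenvalues of `G`, the primitive idempotent
`∏_{j ≠ i} (A - θ_j I) / (θ_i - θ_j)` of the Bose-Mesner algebra, that is, the projection onto the
eigenspace of `A` for `θ i` along the other eigenspaces. -/
def primitiveIdempotent (D : ℕ) (θ : ℕ → ℂ) (i : ℕ) : Matrix X X ℂ :=
  Polynomial.aeval (adjacency G) (Lagrange.basis (Finset.range (D + 1)) θ i)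

/-- The dual distance matrix with index `i`, for the vertex `p` and the ordering
`θ 0, …, θ D` of the eigenvalues of `G`: it is diagonal with `(q, q)`-entry `|X| (E_i)_{p q}`. -/
def dualDistanceMatrix (D : ℕ) (θ : ℕ → ℂ) (p : X) (i : ℕ) : Matrix X X ℂ :=
  Matrix.diagonal fun q => (Fintype.card X : ℂ) * primitiveIdempotent G D θ i p q

/-- The dual adjacency matrix: the dual distance matrix of index `1`. -/
def dualAdjacency (D : ℕ) (θ : ℕ → ℂ) (p : X) : Matrix X X ℂ :=
  dualDistanceMatrix G D θ p 1

end Graph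

/-- The hypercube `Q_D`: vertices are the 0/1 sequences of length `D`, and two of them are adjacent
if and only if they differ in exactly one coordinate. -/
def hypercube (D : ℕ) : SimpleGraph (Fin D → Bool) where
  Adj s t := ∃! i, s i ≠ t i
  symm := ⟨fun s t h => by simpa only [ne_comm] using h⟩
  loopless := ⟨fun s h => by obtain ⟨i, hi, _⟩ := h; exact hi rfl⟩

/-- The sequence `(-1)^i (D - 2i)`. -/
def altEigenvalue (D : ℕ) (i : ℕ) : ℂ := (-1) ^ i * ((D : ℂ) - 2 * (i : ℂ))

/-- The dual adjacency matrix `B` of `Q_D` with respect to the vertex `p` and the ordering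
`(-1)^i (D - 2i)`, `0 ≤ i ≤ D`, of the eigenvalues (`D` even). -/
def hypercubeB (D : ℕ) (p : Fin D → Bool) : Matrix (Fin D → Bool) (Fin D → Bool) ℂ :=
  dualAdjacency (hypercube D) D (altEigenvalue D) p

/-- The given module structure over the anticommutator spin algebra on the standard module of `Q_D`
extends the structure of complex vector space, and `x`, `y` act as `A`, `B`. -/
def IsABStructure (D : ℕ) (p : Fin D → Bool) (_inst : Module (ACSA ℂ) ((Fin D → Bool) → ℂ)) :
    Prop :=
  IsScalarTower ℂ (ACSA ℂ) ((Fin D → Bool) → ℂ) ∧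
    ∀ v : (Fin D → Bool) → ℂ,
      ACSA.gen ℂ .x • v = adjacency (hypercube D) *ᵥ v ∧
      ACSA.gen ℂ .y • v = hypercubeB D p *ᵥ v

end

/-! Let `X`, `Y`, `Z` satisfy the relations. Then `Y + Z` and `Y - Z` send the λ-eigenspace of `X`
into those for 2 - λ and -2 - λ. Applied alternately to `m` with `X m = d m`, they produce a string
with eigenvalues (-1)^i (d - 2i), which are distinct when d is even. If also `Y m = Z m`, the
Casimir element X² + Y² + Z² is the scalar d(d + 2) on the string, and this determines the steps
back (`lower_spinString`). Hence in finite dimension, for `m ≠ 0`, the string has exactly d + 1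
nonzero vectors (`exists_length_spinString`), and these form a type B basis of a simple module
(`hasTypeB_of_highest`).

On the hypercube, expansion in characters shows that B has the constant entry θ_i at distance i from
the base vertex (`hypercubeB_eq`, `dualEntry_eq`). As the θ_i are distinct, stability under T is
stability under A and B. These two satisfy the relations together with a signed adjacency operator
(`isSpinTriple`), so an irreducible T-module is a simple module.

At the endpoint r there is a nonzero w in W with B w = (-1)^r (D - 2r) w and A w = (-1)^r Z w
(`exists_endpoint_vector`). This is an eigenvector of y, not of x, so the string is first run with x
and y exchanged. That forces D - 2r to be a natural number, and the sum of the string is an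
eigenvector of x on which y and z agree (`apply_sum_spinString`, `apply_sum_spinString'`). From it
starts the string that type B asks for. -/

noncomputable section

/-! ### Spin triples and strings of eigenvectors -/

section Chain

variable {K : Type*} [Field K] {M : Type*} [AddCommGroup M] [Module K M]

/-- The defining relations of the anticommutator spin algebra, for three elements of a ring. -/
structure IsSpinTriple {R : Type*} [Ring R] (X Y Z : R) : Prop where
  xy : X * Y + Y * X = 2 * Z
  yz : Y * Z + Z * Y = 2 * X
  zx : Z * X + X * Z = 2 * Y

namespace IsSpinTriple

section Ring

variable {R : Type*} [Ring R] {X Y Z : R}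

theorem rotate (h : IsSpinTriple X Y Z) : IsSpinTriple Y Z X := ⟨h.yz, h.zx, h.xy⟩

theorem swap (h : IsSpinTriple X Y Z) : IsSpinTriple Y X Z :=
  ⟨by rw [add_comm, h.xy], by rw [add_comm, h.zx], by rw [add_comm, h.yz]⟩

theorem neg_left_right (h : IsSpinTriple X Y Z) : IsSpinTriple (-X) Y (-Z) where
  xy := by rw [mul_neg (2 : R), ← h.xy]; noncomm_ring
  yz := by rw [mul_neg (2 : R), ← h.yz]; noncomm_ring
  zx := by rw [← h.zx]; noncomm_ring

/-- The Casimir element commutes with the second generator. -/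
theorem casimir_comm (h : IsSpinTriple X Y Z) :
    (X * X + Y * Y + Z * Z) * Y = Y * (X * X + Y * Y + Z * Z) := by
  -- The commutators of X² and Z² with Y are 2[X, Z] and 2[Z, X], which cancel.
  have h1 : X * (X * Y + Y * X) - (X * Y + Y * X) * X + Z * (Y * Z + Z * Y)
      - (Y * Z + Z * Y) * Z = 0 := by
    rw [h.xy, h.yz]; noncomm_ring
  rw [← sub_eq_zero, ← h1]
  noncomm_ring

theorem casimir_comm' (h : IsSpinTriple X Y Z) :
    (X * X + Y * Y + Z * Z) * Z = Z * (X * X + Y * Y + Z * Z) := by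
  have := h.rotate.casimir_comm
  rw [show X * X + Y * Y + Z * Z = Y * Y + Z * Z + X * X by abel, this]

end Ring

variable {X Y Z : Module.End K M}

theorem xy_apply (h : IsSpinTriple X Y Z) (m : M) : X (Y m) = (2 : K) • Z m - Y (X m) := by
  have := congrArg (fun f : Module.End K M => f m) h.xy
  simp only [two_mul, LinearMap.add_apply, Module.End.mul_apply] at this
  rw [two_smul, ← this]; abel

theorem xz_apply (h : IsSpinTriple X Y Z) (m : M) : X (Z m) = (2 : K) • Y m - Z (X m) := by
  have := congrArg (fun f : Module.End K M => f m) h.zx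
  simp only [two_mul, LinearMap.add_apply, Module.End.mul_apply] at this
  rw [two_smul, ← this]; abel

theorem yz_apply (h : IsSpinTriple X Y Z) (m : M) :
    Y (Z m) + Z (Y m) = (2 : K) • X m := by
  have := congrArg (fun f : Module.End K M => f m) h.yz
  simp only [two_mul, LinearMap.add_apply, Module.End.mul_apply] at this
  rw [two_smul, ← this]

end IsSpinTriple

/-- The string of vectors obtained from `m` by applying `Y + Z` and `Y - Z` alternately, with the
normalization of a module of type `B`. -/
def spinString (Y Z : Module.End K M) (m : M) : ℕ → M
  | 0 => m
  | i + 1 => (2 * ((i : K) + 1))⁻¹ • (Y (spinString Y Z m i) + (-1 : K) ^ i • Z (spinString Y Z m i))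

variable {X Y Z : Module.End K M} {m : M} {d : ℤ}

theorem apply_spinString (h : IsSpinTriple X Y Z) (hx : X m = (d : K) • m) (i : ℕ) :
    X (spinString Y Z m i) = ((-1) ^ i * ((d : K) - 2 * i)) • spinString Y Z m i := by
  induction i with
  | zero => simpa [spinString] using hx
  | succ i ih =>
    have he : ((-1 : K) ^ i) * (-1) ^ i = 1 := by rw [← mul_pow]; simp
    rw [spinString, map_smul, map_add, map_smul, h.xy_apply, h.xz_apply, ih,
      smul_comm _ (2 * ((i : K) + 1))⁻¹]
    congr 1
    simp only [map_smul, pow_succ]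
    push_cast
    generalize (-1 : K) ^ i = e at *
    match_scalars
    · linear_combination (-2 : K) * he
    · ring

/-- Since `Y m = Z m`, on `m` one has Y² + Z² = YZ + ZY = 2X, whence d² + 2d. The value propagates
because the Casimir element commutes with Y and Z. -/
theorem casimir_spinString (h : IsSpinTriple X Y Z) (hx : X m = (d : K) • m) (hyz : Y m = Z m)
    (i : ℕ) : (X * X + Y * Y + Z * Z) (spinString Y Z m i)
      = ((d : K) * (d + 2)) • spinString Y Z m i := by
  induction i with
  | zero =>
    simp only [spinString, LinearMap.add_apply, Module.End.mul_apply]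
    have h1 := h.yz_apply m
    rw [← hyz] at h1 ⊢
    have h2 : Z (Z m) = Z (Y m) := by rw [hyz]
    rw [add_assoc, h1, hx, map_smul, hx]
    module
  | succ i ih =>
    have h1 := congrArg (fun f : Module.End K M => f (spinString Y Z m i)) h.casimir_comm
    have h2 := congrArg (fun f : Module.End K M => f (spinString Y Z m i)) h.casimir_comm'
    rw [Module.End.mul_apply, Module.End.mul_apply, ih] at h1 h2
    rw [spinString, map_smul, map_add, map_smul, h1, h2, map_smul, map_smul]
    module

theorem spinString_eq_zero {n : ℕ} (hn : spinString Y Z m (n + 1) = 0) (k : ℕ) :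
    spinString Y Z m (n + 1 + k) = 0 := by
  induction k with
  | zero => exact hn
  | succ k ih => rw [← add_assoc, spinString, ih]; simp

theorem span_spinString {n : ℕ} (hn : spinString Y Z m (n + 1) = 0) :
    Submodule.span K (Set.range fun i : Fin (n + 1) => spinString Y Z m i)
      = Submodule.span K (Set.range (spinString Y Z m)) := by
  apply le_antisymm
  · exact Submodule.span_mono (by rintro _ ⟨i, rfl⟩; exact ⟨i, rfl⟩)
  · rw [Submodule.span_le]
    rintro _ ⟨i, rfl⟩
    by_cases hi : i < n + 1
    · exact Submodule.subset_span ⟨⟨i, hi⟩, rfl⟩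
    · obtain ⟨k, rfl⟩ := Nat.exists_eq_add_of_le (not_lt.1 hi)
      rw [spinString_eq_zero hn]
      exact Submodule.zero_mem _

variable [CharZero K]

theorem raise_spinString (i : ℕ) :
    Y (spinString Y Z m i) + (-1 : K) ^ i • Z (spinString Y Z m i)
      = (2 * ((i : K) + 1)) • spinString Y Z m (i + 1) := by
  have : (2 * ((i : K) + 1)) ≠ 0 := mul_ne_zero two_ne_zero (by exact_mod_cast i.succ_ne_zero)
  rw [spinString, smul_inv_smul₀ this]

/-- With e = (-1)^i, the square of Y + eZ is (Y² + Z²) + e(YZ + ZY), that is, Casimir - X² + 2eX. On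
the i-th vector this is the scalar 4(i + 1)(d - i). -/
theorem lower_spinString (h : IsSpinTriple X Y Z) (hx : X m = (d : K) • m) (hyz : Y m = Z m)
    (i : ℕ) : Y (spinString Y Z m (i + 1)) + (-1 : K) ^ i • Z (spinString Y Z m (i + 1))
      = (2 * ((d : K) - i)) • spinString Y Z m i := by
  have hi : ((i : K) + 1) ≠ 0 := by exact_mod_cast i.succ_ne_zero
  have h1 := casimir_spinString h hx hyz i
  have h2 := apply_spinString h hx i
  have h3 := h.yz_apply (spinString Y Z m i)
  simp only [LinearMap.add_apply, Module.End.mul_apply] at h1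
  rw [spinString]
  simp only [map_smul, map_add]
  rw [h2, map_smul, h2] at h1
  rw [h2] at h3
  have he : ((-1 : K) ^ i) * (-1) ^ i = 1 := by rw [← mul_pow]; simp
  generalize (-1 : K) ^ i = e at *
  generalize spinString Y Z m i = v at *
  have h4 : Y (Y v) + e • Y (Z v) + e • (Z (Y v) + e • Z (Z v))
      = (4 * ((i : K) + 1) * ((d : K) - i)) • v := by
    have : Y (Y v) + e • Y (Z v) + e • (Z (Y v) + e • Z (Z v))
      = (Y (Y v) + (e * e) • Z (Z v)) + e • (Y (Z v) + Z (Y v)) := by module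
    rw [this, he, h3, one_smul, show Y (Y v) + Z (Z v) = ((d : K) * (d + 2)) • v
      - (e * ((d : K) - 2 * i)) • (e * ((d : K) - 2 * i)) • v by rw [← h1]; abel]
    match_scalars
    linear_combination (2 * ((d : K) - 2 * i) - (((d : K) - 2 * i)) ^ 2) * he
  have h5 : (2 * ((i : K) + 1))⁻¹ • (Y (Y v) + e • Y (Z v))
      + e • (2 * ((i : K) + 1))⁻¹ • (Z (Y v) + e • Z (Z v))
      = (2 * ((i : K) + 1))⁻¹ • (Y (Y v) + e • Y (Z v) + e • (Z (Y v) + e • Z (Z v))) := by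
    module
  rw [h5, h4, smul_smul]
  congr 1
  field_simp
  ring

/-- Indices of equal parity are separated by d - 2i. For opposite parities a coincidence would force
i + j = d, an odd number equal to an even one. -/
theorem altInt_injective (hd : Even d) :
    Function.Injective fun i : ℕ => (-1 : ℤ) ^ i * (d - 2 * i) := by
  intro i j hij
  obtain ⟨c, rfl⟩ := hd
  simp only at hij
  rcases Nat.even_or_odd i with hi | hi <;> rcases Nat.even_or_odd j with hj | hj <;>
    simp only [hi.neg_one_pow, hj.neg_one_pow] at hij
  · omega
  · obtain ⟨a, rfl⟩ := hi; obtain ⟨b, rfl⟩ := hj; push_cast at hij; omega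
  · obtain ⟨a, rfl⟩ := hi; obtain ⟨b, rfl⟩ := hj; push_cast at hij; omega
  · omega

theorem altEigen_injective (hd : Even d) :
    Function.Injective fun i : ℕ => (-1 : K) ^ i * ((d : K) - 2 * i) := by
  intro i j hij
  apply altInt_injective hd
  simp only at hij ⊢
  exact_mod_cast hij

theorem spinString_linearIndependent (h : IsSpinTriple X Y Z) (hx : X m = (d : K) • m)
    (hd : Even d) {ι : Type*} (f : ι → ℕ) (hf : Function.Injective f)
    (hne : ∀ i, spinString Y Z m (f i) ≠ 0) :
    LinearIndependent K fun i => spinString Y Z m (f i) :=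
  X.eigenvectors_linearIndependent' _ ((altEigen_injective (K := K) hd).comp hf) _ fun i =>
    Module.End.hasEigenvector_iff.2
      ⟨Module.End.mem_eigenspace_iff.2 (apply_spinString h hx (f i)), hne i⟩

/-- In finite dimension the string has length `d + 1`. -/
theorem exists_length_spinString [FiniteDimensional K M] (h : IsSpinTriple X Y Z)
    (hx : X m = (d : K) • m) (hyz : Y m = Z m) (hd : Even d) (hm : m ≠ 0) :
    ∃ n : ℕ, d = n ∧ spinString Y Z m (n + 1) = 0 ∧ ∀ i ≤ n, spinString Y Z m i ≠ 0 := by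
  classical
  have hex : ∃ i, spinString Y Z m i = 0 := by
    by_contra! hne
    have := spinString_linearIndependent h hx hd id Function.injective_id hne
    exact not_finite_iff_infinite.2 inferInstance this.finite
  obtain ⟨n, hn⟩ : ∃ n, Nat.find hex = n + 1 :=
    Nat.exists_eq_succ_of_ne_zero fun h0 => hm (by simpa [h0, spinString] using Nat.find_spec hex)
  have hmin : ∀ i ≤ n, spinString Y Z m i ≠ 0 := fun i hi => Nat.find_min hex (by omega)
  have h0 : spinString Y Z m (n + 1) = 0 := hn ▸ Nat.find_spec hex
  refine ⟨n, ?_, h0, hmin⟩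
  -- Stepping back from the vanishing vector gives 2(d - n) times the last nonzero one, so d = n.
  have h1 := lower_spinString h hx hyz n
  rw [h0, map_zero, map_zero, smul_zero, add_zero, eq_comm, smul_eq_zero_iff_left (hmin n le_rfl)]
    at h1
  have h2 : (d : K) = n := by simpa [sub_eq_zero] using h1
  exact_mod_cast h2

theorem spinString_zero_y (hyz : Y m = Z m) :
    Y (spinString Y Z m 0) = spinString Y Z m 1 ∧ Z (spinString Y Z m 0) = spinString Y Z m 1 := by
  have := raise_spinString (Y := Y) (Z := Z) (m := m) 0
  simp only [spinString, pow_zero, one_smul, Nat.cast_zero, zero_add, mul_one, ← hyz] at *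
  rw [← two_smul K (Y m), inv_smul_smul₀ two_ne_zero]
  simp

/-- Away from the start, the steps back and forward carry opposite signs of Z, so half their sum
isolates Y; their difference isolates Z. -/
theorem spinString_succ_y (h : IsSpinTriple X Y Z) (hx : X m = (d : K) • m) (hyz : Y m = Z m)
    (i : ℕ) : Y (spinString Y Z m (i + 1)) = ((d : K) - i) • spinString Y Z m i
      + ((i : K) + 2) • spinString Y Z m (i + 2) := by
  have h1 := lower_spinString h hx hyz i
  have h2 := raise_spinString (Y := Y) (Z := Z) (m := m) (i + 1)
  apply smul_right_injective M (two_ne_zero (α := K))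
  simp only
  calc _ = (Y (spinString Y Z m (i + 1)) + (-1 : K) ^ i • Z (spinString Y Z m (i + 1)))
        + (Y (spinString Y Z m (i + 1)) + (-1 : K) ^ (i + 1) • Z (spinString Y Z m (i + 1))) := by
        rw [pow_succ]; module
    _ = _ := by rw [h1, h2]; push_cast; module

theorem spinString_succ_z (h : IsSpinTriple X Y Z) (hx : X m = (d : K) • m) (hyz : Y m = Z m)
    (i : ℕ) : Z (spinString Y Z m (i + 1)) = ((-1) ^ i * ((d : K) - i)) • spinString Y Z m i
      + ((-1) ^ (i + 1) * ((i : K) + 2)) • spinString Y Z m (i + 2) := by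
  have h1 := lower_spinString h hx hyz i
  have h2 := raise_spinString (Y := Y) (Z := Z) (m := m) (i + 1)
  have he : ((-1 : K) ^ i) * (-1) ^ i = 1 := by rw [← mul_pow]; simp
  apply smul_right_injective M (two_ne_zero (α := K))
  simp only
  calc _ = (2 * ((-1 : K) ^ i * (-1) ^ i)) • Z (spinString Y Z m (i + 1)) := by rw [he, mul_one]
    _ = (-1 : K) ^ i • ((Y (spinString Y Z m (i + 1))
          + (-1 : K) ^ i • Z (spinString Y Z m (i + 1)))
        - (Y (spinString Y Z m (i + 1)) + (-1 : K) ^ (i + 1) • Z (spinString Y Z m (i + 1)))) := by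
        rw [pow_succ]; module
    _ = _ := by rw [h1, h2, pow_succ]; push_cast; module

theorem mapsTo_span_spinString (h : IsSpinTriple X Y Z) (hx : X m = (d : K) • m)
    (hyz : Y m = Z m) {v : M} (hv : v ∈ Submodule.span K (Set.range (spinString Y Z m))) :
    X v ∈ Submodule.span K (Set.range (spinString Y Z m)) ∧
    Y v ∈ Submodule.span K (Set.range (spinString Y Z m)) ∧
    Z v ∈ Submodule.span K (Set.range (spinString Y Z m)) := by
  set S := Submodule.span K (Set.range (spinString Y Z m)) with hS
  have hs (i : ℕ) : spinString Y Z m i ∈ S := Submodule.subset_span ⟨i, rfl⟩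
  suffices S ≤ S.comap X ⊓ (S.comap Y ⊓ S.comap Z) from this hv
  conv_lhs => rw [hS]
  rw [Submodule.span_le]
  rintro _ ⟨i, rfl⟩
  refine ⟨?_, ?_, ?_⟩
  · simpa [apply_spinString h hx i] using S.smul_mem _ (hs i)
  · change Y _ ∈ S
    cases i with
    | zero => rw [(spinString_zero_y hyz).1]; exact hs 1
    | succ i =>
      rw [spinString_succ_y h hx hyz]
      exact S.add_mem (S.smul_mem _ (hs _)) (S.smul_mem _ (hs _))
  · change Z _ ∈ S
    cases i with
    | zero => rw [(spinString_zero_y hyz).2]; exact hs 1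
    | succ i =>
      rw [spinString_succ_z h hx hyz]
      exact S.add_mem (S.smul_mem _ (hs _)) (S.smul_mem _ (hs _))

/-- The j-th vector receives d - j from its successor and j from its predecessor, d in all. Only the
cut at k leaves correction terms, and these vanish at the end of the string. -/
theorem apply_sum_spinString (h : IsSpinTriple X Y Z) (hx : X m = (d : K) • m)
    (hyz : Y m = Z m) (k : ℕ) :
    Y (∑ i ∈ Finset.range (k + 1), spinString Y Z m i)
      = (d : K) • (∑ i ∈ Finset.range (k + 1), spinString Y Z m i)
        - ((d : K) - k) • spinString Y Z m k + ((k : K) + 1) • spinString Y Z m (k + 1) := by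
  induction k with
  | zero => simp [(spinString_zero_y hyz).1]
  | succ k ih =>
    rw [Finset.sum_range_succ, map_add, ih, spinString_succ_y h hx hyz]
    push_cast
    module

/-- With the signs of Z, the two contributions add up to (-1)^j (d - 2j), the eigenvalue of X. -/
theorem apply_sum_spinString' (h : IsSpinTriple X Y Z) (hx : X m = (d : K) • m)
    (hyz : Y m = Z m) (k : ℕ) :
    Z (∑ i ∈ Finset.range (k + 1), spinString Y Z m i)
      = X (∑ i ∈ Finset.range (k + 1), spinString Y Z m i)
        - ((-1) ^ k * ((d : K) - k)) • spinString Y Z m k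
        + ((-1) ^ k * ((k : K) + 1)) • spinString Y Z m (k + 1) := by
  induction k with
  | zero => simp [(spinString_zero_y hyz).2, apply_spinString h hx 0]
  | succ k ih =>
    rw [Finset.sum_range_succ, map_add, map_add, ih, spinString_succ_z h hx hyz,
      apply_spinString h hx, pow_succ]
    push_cast
    module

end Chain

theorem IsSpinTriple.map {R S F : Type*} [Ring R] [Ring S] [FunLike F R S] [RingHomClass F R S]
    {X Y Z : R} (h : IsSpinTriple X Y Z) (f : F) : IsSpinTriple (f X) (f Y) (f Z) where
  xy := by simpa [map_ofNat] using congrArg f h.xy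
  yz := by simpa [map_ofNat] using congrArg f h.yz
  zx := by simpa [map_ofNat] using congrArg f h.zx

/-! ### Modules over the anticommutator spin algebra -/

section ACSAModule

variable {K : Type*} [Field K]

namespace ACSA

theorem isSpinTriple_gen : IsSpinTriple (gen K .x) (gen K .y) (gen K .z) where
  xy := by simpa [gen, map_ofNat] using RingQuot.mkAlgHom_rel K (ACSARel.xy (K := K))
  yz := by simpa [gen, map_ofNat] using RingQuot.mkAlgHom_rel K (ACSARel.yz (K := K))
  zx := by simpa [gen, map_ofNat] using RingQuot.mkAlgHom_rel K (ACSARel.zx (K := K))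

/-- Induction over the anticommutator spin algebra. -/
theorem induction {C : ACSA K → Prop} (algebraMap : ∀ c, C (algebraMap K (ACSA K) c))
    (gen : ∀ g, C (gen K g)) (mul : ∀ a b, C a → C b → C (a * b))
    (add : ∀ a b, C a → C b → C (a + b)) (a : ACSA K) : C a := by
  obtain ⟨f, rfl⟩ := RingQuot.mkAlgHom_surjective K (ACSARel K) a
  induction f using FreeAlgebra.induction with
  | grade0 c => rw [AlgHom.commutes]; exact algebraMap c
  | grade1 g => exact gen g
  | mul a b ha hb => rw [map_mul]; exact mul _ _ ha hb
  | add a b ha hb => rw [map_add]; exact add _ _ ha hb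

variable {M : Type*} [AddCommGroup M] [Module K M] [Module (ACSA K) M]

theorem smul_z [CharZero K] (v : M) : gen K .z • v
    = (2⁻¹ : K) • (gen K .x • gen K .y • v + gen K .y • gen K .x • v) := by
  have := congrArg (· • v) (isSpinTriple_gen (K := K)).xy
  simp only [add_smul, mul_smul, two_mul] at this
  rw [this, ← two_smul K, inv_smul_smul₀ two_ne_zero]

theorem stable_of_xy [CharZero K] {S : Submodule K M} (hx : ∀ v ∈ S, gen K .x • v ∈ S)
    (hy : ∀ v ∈ S, gen K .y • v ∈ S) (g : ACSAGen) : ∀ v ∈ S, gen K g • v ∈ S := by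
  intro v hv
  cases g with
  | x => exact hx v hv
  | y => exact hy v hv
  | z =>
    rw [smul_z]
    exact S.smul_mem _ (S.add_mem (hx _ (hy _ hv)) (hy _ (hx _ hv)))

variable [IsScalarTower K (ACSA K) M]

/-- A subspace stable under the generators, as a submodule. -/
def submoduleOfStable (S : Submodule K M) (hS : ∀ g, ∀ v ∈ S, gen K g • v ∈ S) :
    Submodule (ACSA K) M where
  __ := S
  smul_mem' a v hv := by
    revert v
    refine ACSA.induction (C := fun a => ∀ v ∈ S.carrier, a • v ∈ S.carrier) ?_ hS ?_ ?_ a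
    · intro c v hv
      rw [algebraMap_smul]
      exact S.smul_mem c hv
    · intro a b ha hb v hv
      rw [mul_smul]
      exact ha _ (hb _ hv)
    · intro a b ha hb v hv
      rw [add_smul]
      exact S.add_mem (ha _ hv) (hb _ hv)

@[simp]
theorem mem_submoduleOfStable {S : Submodule K M} {hS : ∀ g, ∀ v ∈ S, gen K g • v ∈ S} {v : M} :
    v ∈ submoduleOfStable S hS ↔ v ∈ S := Iff.rfl

variable (K M) in
/-- The operator by which a generator acts. -/
def op (g : ACSAGen) : Module.End K M :=
  haveI := IsScalarTower.to_smulCommClass (R := K) (A := ACSA K) (M := M)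
  Algebra.lsmul K K M (gen K g)

theorem op_apply (g : ACSAGen) (v : M) : op K M g v = gen K g • v := rfl

theorem isSpinTriple_op : IsSpinTriple (op K M .x) (op K M .y) (op K M .z) :=
  haveI := IsScalarTower.to_smulCommClass (R := K) (A := ACSA K) (M := M)
  (isSpinTriple_gen (K := K)).map (Algebra.lsmul K K M)

theorem eq_top_of_stable [IsSimpleModule (ACSA K) M] {S : Submodule K M}
    (hS : ∀ g, ∀ v ∈ S, gen K g • v ∈ S) {m : M} (hm : m ≠ 0) (hmS : m ∈ S) : S = ⊤ := by
  rcases eq_bot_or_eq_top (submoduleOfStable S hS) with h | h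
  · exact absurd ((Submodule.mem_bot _).1 (h ▸ (mem_submoduleOfStable (hS := hS)).2 hmS)) hm
  · rw [eq_top_iff]
    intro v _
    exact (mem_submoduleOfStable (hS := hS)).1 (h ▸ Submodule.mem_top)

variable [CharZero K] [FiniteDimensional K M] [IsSimpleModule (ACSA K) M]

/-- A finite-dimensional simple module with an eigenvector of `x` killed by `y - z` has type `B`. -/
theorem hasTypeB_of_highest {m : M} (hm : m ≠ 0) {n : ℕ} (hn : Even n)
    (hx : gen K .x • m = (n : K) • m) (hyz : gen K .y • m = gen K .z • m) :
    HasTypeB K n M := by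
  have h := isSpinTriple_op (K := K) (M := M)
  have hd : Even (n : ℤ) := by exact_mod_cast hn
  have hx' : op K M .x m = ((n : ℤ) : K) • m := by simpa [op_apply] using hx
  have hyz' : op K M .y m = op K M .z m := hyz
  obtain ⟨n', hn', h0, hne⟩ := exists_length_spinString h hx' hyz' hd hm
  obtain rfl : n = n' := by exact_mod_cast hn'
  set s := spinString (op K M .y) (op K M .z) m with hs
  have hli : LinearIndependent K fun i : Fin (n + 1) => s i :=
    spinString_linearIndependent h hx' hd (fun i : Fin (n + 1) => (i : ℕ)) Fin.val_injective
      fun i => hne i (by omega)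
  have htop : Submodule.span K (Set.range s) = ⊤ := by
    refine eq_top_of_stable ?_ hm (Submodule.subset_span ⟨0, rfl⟩)
    intro g v hv
    have := mapsTo_span_spinString h hx' hyz' hv
    cases g with
    | x => exact this.1
    | y => exact this.2.1
    | z => exact this.2.2
  -- Only the negative indices need the value 0 put in; at n + 1 the string vanishes by itself.
  refine ⟨hn, Module.Basis.mk hli ?_, fun i => if 0 ≤ i then s i.toNat else 0, ?_, ?_, ?_, ?_⟩
  · rw [span_spinString h0, htop]
  · intro i; simp
  · simp
  · beta_reduce
    rw [if_pos (by omega), show ((n : ℤ) + 1).toNat = n + 1 by omega]; exact h0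
  · intro i hi hin
    lift i to ℕ using hi
    beta_reduce
    have hxi : gen K .x • s i = ((-1) ^ i * (((n : ℤ) : K) - 2 * i)) • s i := apply_spinString h hx' i
    rw [if_pos (by omega), Int.toNat_natCast, if_pos (by omega : (0 : ℤ) ≤ (i : ℤ) + 1),
      show ((i : ℤ) + 1).toNat = i + 1 by omega]
    cases i with
    | zero =>
      have h1 : gen K .y • s 0 = s 1 := (spinString_zero_y hyz').1
      have h2 : gen K .z • s 0 = s 1 := (spinString_zero_y hyz').2
      rw [hxi, h1, h2]
      simp
    | succ i =>
      have h1 : gen K .y • s (i + 1) = (((n : ℤ) : K) - i) • s i + ((i : K) + 2) • s (i + 2) :=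
        spinString_succ_y h hx' hyz' i
      have h2 : gen K .z • s (i + 1) = ((-1) ^ i * (((n : ℤ) : K) - i)) • s i
          + ((-1) ^ (i + 1) * ((i : K) + 2)) • s (i + 2) :=
        spinString_succ_z h hx' hyz' i
      have h3 : (((i + 1 : ℕ) : ℤ) - 1) = i := by push_cast; ring
      rw [hxi, h1, h2, h3, if_pos (by omega), Int.toNat_natCast]
      simp only [zpow_natCast]
      push_cast
      refine ⟨?_, ?_, ?_⟩ <;> module

/-- A finite-dimensional simple module with an eigenvector of `y` killed by `x - σ z`, where
`σ = ±1`, has type `B`. -/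
theorem exists_hasTypeB {m : M} (hm : m ≠ 0) {σ : K} (hσ : σ = 1 ∨ σ = -1) {d : ℤ} (hd : Even d)
    (hy : gen K .y • m = (σ * d) • m) (hxz : gen K .x • m = σ • gen K .z • m) :
    ∃ n : ℕ, d = n ∧ HasTypeB K n M := by
  have hσσ : σ * σ = 1 := by rcases hσ with rfl | rfl <;> simp
  -- Exchange x and y, and absorb σ by the sign change of two generators.
  have h : IsSpinTriple (σ • op K M .y) (op K M .x) (σ • op K M .z) := by
    rcases hσ with rfl | rfl
    · simpa using isSpinTriple_op.swap
    · simpa using isSpinTriple_op.swap.neg_left_right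
  have hx' : (σ • op K M .y) m = (d : K) • m := by
    rw [LinearMap.smul_apply, op_apply, hy, smul_smul, ← mul_assoc, hσσ, one_mul]
  have hyz' : op K M .x m = (σ • op K M .z) m := hxz
  obtain ⟨n, rfl, h0, hne⟩ := exists_length_spinString h hx' hyz' hd hm
  refine ⟨n, rfl, ?_⟩
  have h1 := apply_sum_spinString h hx' hyz' n
  have h2 := apply_sum_spinString' h hx' hyz' n
  simp only [h0, Int.cast_natCast, sub_self, mul_zero, zero_smul, smul_zero, add_zero, sub_zero,
    LinearMap.smul_apply] at h1 h2
  have hli := spinString_linearIndependent h hx' hd (fun i : Fin (n + 1) => (i : ℕ))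
    Fin.val_injective fun i => hne i (by omega)
  refine hasTypeB_of_highest (m := _) ?_ (by exact_mod_cast hd) h1 ?_
  -- The sum is nonzero, being a combination of independent vectors with all coefficients 1.
  · intro hsum
    rw [Finset.sum_range] at hsum
    have := Fintype.linearIndependent_iff.1 hli (fun _ => 1) (by simpa using hsum) 0
    exact one_ne_zero this
  · have h3 := congrArg (σ • ·) h2
    simp only [smul_smul, hσσ, one_smul] at h3
    exact h3.symm

end ACSA

end ACSAModule

/-! ### Polynomials in a matrix, and stability under T -/

section MatrixPolynomial

variable {X : Type*} [Fintype X] [DecidableEq X]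

theorem Matrix.aeval_mulVec_of_eigenvector {N : Matrix X X ℂ} {v : X → ℂ} {c : ℂ}
    (h : N *ᵥ v = c • v) (P : Polynomial ℂ) :
    Polynomial.aeval N P *ᵥ v = P.eval c • v := by
  induction P using Polynomial.induction_on' with
  | add P Q hP hQ => simp only [map_add, Matrix.add_mulVec, hP, hQ, Polynomial.eval_add, add_smul]
  | monomial n a =>
    have hpow : N ^ n *ᵥ v = c ^ n • v := by
      induction n with
      | zero => simp
      | succ n ih =>
        rw [pow_succ, ← Matrix.mulVec_mulVec, h, Matrix.mulVec_smul, ih, smul_smul, pow_succ']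
    rw [Polynomial.aeval_monomial, Polynomial.eval_monomial, ← Matrix.mulVec_mulVec, hpow,
      Matrix.mulVec_smul, Algebra.algebraMap_eq_smul_one, Matrix.smul_mulVec, Matrix.one_mulVec,
      smul_smul, mul_comm]

theorem Matrix.aeval_diagonal (b : X → ℂ) (P : Polynomial ℂ) :
    Polynomial.aeval (Matrix.diagonal b) P = Matrix.diagonal fun q => P.eval (b q) := by
  ext s t
  have h : Matrix.diagonal b *ᵥ Pi.single t 1 = b t • Pi.single t 1 := by
    ext q
    rw [Matrix.mulVec_diagonal]
    rcases eq_or_ne q t with rfl | hq <;> simp [*]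
  have := congrFun (Matrix.aeval_mulVec_of_eigenvector h P) s
  rw [Matrix.mulVec_single_one] at this
  rw [← Matrix.col_apply (Polynomial.aeval (Matrix.diagonal b) P), this, Matrix.diagonal_apply]
  rcases eq_or_ne s t with rfl | hs <;> simp [*]

theorem Matrix.aeval_mulVec_mem {N : Matrix X X ℂ} {W : Submodule ℂ (X → ℂ)}
    (hN : ∀ w ∈ W, N *ᵥ w ∈ W) (P : Polynomial ℂ) : ∀ w ∈ W, Polynomial.aeval N P *ᵥ w ∈ W := by
  induction P using Polynomial.induction_on' with
  | add P Q hP hQ =>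
    intro w hw
    rw [map_add, Matrix.add_mulVec]
    exact W.add_mem (hP w hw) (hQ w hw)
  | monomial n a =>
    have hpow : ∀ w ∈ W, N ^ n *ᵥ w ∈ W := by
      induction n with
      | zero => simp
      | succ n ih =>
        intro w hw
        rw [pow_succ, ← Matrix.mulVec_mulVec]
        exact ih _ (hN w hw)
    intro w hw
    rw [Polynomial.aeval_monomial, ← Matrix.mulVec_mulVec, Algebra.algebraMap_eq_smul_one,
      Matrix.smul_mulVec, Matrix.one_mulVec]
    exact W.smul_mem _ (hpow w hw)

theorem isTModule_iff (G : SimpleGraph X) (p : X) (W : Submodule ℂ (X → ℂ)) :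
    IsTModule G p W ↔ (∀ w ∈ W, adjacency G *ᵥ w ∈ W) ∧
      ∀ i, ∀ w ∈ W, dualIdempotent G p i *ᵥ w ∈ W := by
  constructor
  · intro h
    refine ⟨h _ ?_, fun i => h _ ?_⟩
    · exact Algebra.subset_adjoin (Or.inl (Algebra.subset_adjoin rfl))
    · exact Algebra.subset_adjoin (Or.inr (Submodule.subset_span ⟨i, rfl⟩))
  · rintro ⟨hA, hE⟩
    let S : Subalgebra ℂ (Matrix X X ℂ) :=
      { carrier := {N | ∀ w ∈ W, N *ᵥ w ∈ W}
        mul_mem' := fun {a b} ha hb w hw => by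
          rw [← Matrix.mulVec_mulVec]; exact ha _ (hb _ hw)
        add_mem' := fun {a b} ha hb w hw => by
          rw [Matrix.add_mulVec]; exact W.add_mem (ha w hw) (hb w hw)
        algebraMap_mem' := fun c w hw => by
          rw [Algebra.algebraMap_eq_smul_one, Matrix.smul_mulVec, Matrix.one_mulVec]
          exact W.smul_mem c hw }
    have hS : terwilliger G p ≤ S := by
      refine Algebra.adjoin_le (Set.union_subset ?_ ?_)
      · have : boseMesner G ≤ S := Algebra.adjoin_le (Set.singleton_subset_iff.2 hA)
        exact this
      · have : dualBoseMesner G p ≤ Subalgebra.toSubmodule S :=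
          Submodule.span_le.2 (by rintro _ ⟨i, rfl⟩; exact hE i)
        exact this
    exact fun N hN => hS hN

end MatrixPolynomial

/-! ### Characters of the hypercube and the dual adjacency matrix -/

namespace Hypercube

variable {D : ℕ}

/-- The vertex obtained by changing one coordinate. -/
def flip (k : Fin D) (s : Fin D → Bool) : Fin D → Bool := Function.update s k (!s k)

/-- The sign recording whether `s` agrees with `p` in a coordinate. -/
def sgn (p : Fin D → Bool) (k : Fin D) (s : Fin D → Bool) : ℂ := if s k = p k then 1 else -1

/-- The product of the signs. -/
def parity (p s : Fin D → Bool) : ℂ := ∏ k, sgn p k s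

/-- The diagonal entries of the dual adjacency matrix. -/
def dualEntry (p s : Fin D → Bool) : ℂ := parity p s * ∑ k, sgn p k s

theorem flip_apply_self (k : Fin D) (s : Fin D → Bool) : flip k s k = !s k := by simp [flip]

theorem flip_apply_of_ne {j k : Fin D} (h : j ≠ k) (s : Fin D → Bool) : flip k s j = s j := by
  simp [flip, h]

theorem flip_flip (k : Fin D) (s : Fin D → Bool) : flip k (flip k s) = s := by
  simp [flip]

theorem flip_comm (j k : Fin D) (s : Fin D → Bool) : flip j (flip k s) = flip k (flip j s) := by
  rcases eq_or_ne j k with rfl | h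
  · rfl
  · simp [flip, h, h.symm, Function.update_comm h]

theorem sgn_flip_self (p : Fin D → Bool) (k : Fin D) (s : Fin D → Bool) :
    sgn p k (flip k s) = -sgn p k s := by
  simp only [sgn, flip, Function.update_self]
  cases s k <;> cases p k <;> simp

theorem sgn_flip_of_ne (p : Fin D → Bool) {j k : Fin D} (h : k ≠ j) (s : Fin D → Bool) :
    sgn p k (flip j s) = sgn p k s := by
  simp [sgn, flip, h]

theorem sgn_mul_self (p : Fin D → Bool) (k : Fin D) (s : Fin D → Bool) :
    sgn p k s * sgn p k s = 1 := by
  unfold sgn; split <;> simp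

@[simp] theorem sgn_base (p : Fin D → Bool) (k : Fin D) : sgn p k p = 1 := by simp [sgn]

theorem parity_mul_self (p s : Fin D → Bool) : parity p s * parity p s = 1 := by
  simp [parity, ← Finset.prod_mul_distrib, sgn_mul_self]

theorem prod_sgn_flip (p : Fin D → Bool) (j : Fin D) (s : Fin D → Bool) (t : Finset (Fin D)) :
    ∏ k ∈ t, sgn p k (flip j s) = (if j ∈ t then -1 else 1) * ∏ k ∈ t, sgn p k s := by
  split_ifs with h
  · rw [← Finset.mul_prod_erase _ _ h, ← Finset.mul_prod_erase (a := j) _ (fun k => sgn p k s) h,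
      sgn_flip_self, Finset.prod_congr rfl fun k hk => sgn_flip_of_ne p (Finset.ne_of_mem_erase hk) s]
    ring
  · rw [one_mul]
    exact Finset.prod_congr rfl fun k hk => sgn_flip_of_ne p (ne_of_mem_of_not_mem hk h) s

theorem parity_flip (p : Fin D → Bool) (j : Fin D) (s : Fin D → Bool) :
    parity p (flip j s) = -parity p s := by
  simp [parity, prod_sgn_flip]

theorem sum_sgn_flip (p : Fin D → Bool) (j : Fin D) (s : Fin D → Bool) :
    ∑ k, sgn p k (flip j s) = ∑ k, sgn p k s - 2 * sgn p j s := by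
  rw [← Finset.add_sum_erase _ _ (Finset.mem_univ j),
    ← Finset.add_sum_erase _ (fun k => sgn p k s) (Finset.mem_univ j), sgn_flip_self,
    Finset.sum_congr rfl fun k hk => sgn_flip_of_ne p (Finset.ne_of_mem_erase hk) s]
  ring

theorem dualEntry_flip (p : Fin D → Bool) (j : Fin D) (s : Fin D → Bool) :
    dualEntry p (flip j s) = -dualEntry p s + 2 * (parity p s * sgn p j s) := by
  rw [dualEntry, parity_flip, sum_sgn_flip, dualEntry]; ring

theorem adj_iff {s t : Fin D → Bool} : (hypercube D).Adj s t ↔ ∃ k, flip k s = t := by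
  constructor
  · rintro ⟨k, hk, hu⟩
    refine ⟨k, ?_⟩
    ext j
    rcases eq_or_ne j k with rfl | h
    · simp only [flip, Function.update_self]
      revert hk; cases s j <;> cases t j <;> simp
    · simp only [flip, Function.update_of_ne h]
      by_contra hne
      exact h (hu j (by simpa using hne))
  · rintro ⟨k, rfl⟩
    refine ⟨k, by simp [flip], fun j hj => ?_⟩
    by_contra h
    exact hj (by simp [flip, h])

theorem flip_injective (s : Fin D → Bool) : Function.Injective fun k => flip k s := by
  intro j k h
  by_contra hne
  have := congrFun h j
  simp [flip, hne] at this

theorem adjacency_mulVec (f : (Fin D → Bool) → ℂ) (s : Fin D → Bool) :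
    (adjacency (hypercube D) *ᵥ f) s = ∑ k, f (flip k s) := by
  classical
  rw [adjacency, SimpleGraph.adjMatrix_mulVec_apply]
  symm
  refine Finset.sum_bij (fun k _ => flip k s) ?_ ?_ ?_ ?_
  · intro k _
    rw [SimpleGraph.mem_neighborFinset, adj_iff]
    exact ⟨k, rfl⟩
  · intro j _ k _ h
    exact flip_injective s h
  · intro t ht
    rw [SimpleGraph.mem_neighborFinset, adj_iff] at ht
    obtain ⟨k, hk⟩ := ht
    exact ⟨k, Finset.mem_univ k, hk⟩
  · intros; rfl

theorem prod_sgn_eigenvector (p : Fin D → Bool) (t : Finset (Fin D)) :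
    adjacency (hypercube D) *ᵥ (fun s => ∏ k ∈ t, sgn p k s)
      = ((D : ℂ) - 2 * t.card) • fun s => ∏ k ∈ t, sgn p k s := by
  ext s
  rw [adjacency_mulVec]
  simp only [prod_sgn_flip, ← Finset.sum_mul, Pi.smul_apply, smul_eq_mul]
  congr 1
  have : ∀ j : Fin D, (if j ∈ t then (-1 : ℂ) else 1) = 1 - 2 * (if j ∈ t then 1 else 0) := by
    intro j; split_ifs <;> norm_num
  simp only [this, Finset.sum_sub_distrib, ← Finset.mul_sum]
  simp

/-- Orthogonality of characters: the sum factors over coordinates, and a coordinate where q and s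
differ contributes 1 - 1. -/
theorem sum_prod_sgn (p q s : Fin D → Bool) :
    ∑ t : Finset (Fin D), (∏ k ∈ t, sgn p k q) * ∏ k ∈ t, sgn p k s
      = if q = s then 2 ^ D else 0 := by
  simp only [← Finset.prod_mul_distrib]
  rw [← Finset.powerset_univ, ← Finset.prod_one_add]
  split_ifs with h
  · subst h
    simp [sgn_mul_self, one_add_one_eq_two]
  · obtain ⟨k, hk⟩ := Function.ne_iff.1 h
    refine Finset.prod_eq_zero (Finset.mem_univ k) ?_
    unfold sgn
    revert hk; cases q k <;> cases s k <;> cases p k <;> simp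

/-- The sets involved are the complements of single coordinates k, and their products are parity
times the k-th sign, since signs square to 1. -/
theorem sum_prod_sgn_of_card (p q : Fin D → Bool) :
    (∑ t : Finset (Fin D), if t.card + 1 = D then ∏ k ∈ t, sgn p k q else 0)
      = dualEntry p q := by
  rw [← Finset.sum_filter, dualEntry, Finset.mul_sum]
  symm
  refine Finset.sum_bij (fun k _ => Finset.univ.erase k) ?_ ?_ ?_ ?_
  · intro k _
    have := k.pos
    simp [Finset.card_erase_of_mem]
    omega
  · intro j _ k _ h
    by_contra hne
    have : j ∈ Finset.univ.erase k := by simp [hne]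
    rw [← h] at this
    simp at this
  · intro t ht
    have h1 : t.card + 1 = D := by simpa using ht
    have h2 : tᶜ.card = 1 := by rw [Finset.card_compl, Fintype.card_fin]; omega
    obtain ⟨k, hk⟩ := Finset.card_eq_one.1 h2
    refine ⟨k, Finset.mem_univ k, ?_⟩
    rw [← compl_compl t, hk, Finset.compl_singleton]
  · intro k _
    rw [parity, ← Finset.mul_prod_erase _ _ (Finset.mem_univ k)]
    linear_combination (∏ j ∈ Finset.univ.erase k, sgn p j q) * sgn_mul_self p k q

theorem altEigenvalue_injective (hD : Even D) : Function.Injective (altEigenvalue D) := by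
  have : Even (D : ℤ) := by exact_mod_cast hD
  intro i j h
  exact altEigen_injective (K := ℂ) this (by simpa [altEigenvalue] using h)

/-- As D is even, D - 2c is θ_c for c even and θ_(D-c) for c odd. For D = 0 the index 1 is outside
the range, yet the polynomial vanishes at 0, in accordance with F_1 = 0. -/
theorem eval_basis_one (hD : Even D) {c : ℕ} (hc : c ≤ D) :
    (Lagrange.basis (Finset.range (D + 1)) (altEigenvalue D) 1).eval ((D : ℂ) - 2 * c)
      = if c + 1 = D then 1 else 0 := by
  obtain ⟨j, hj, hje, hj1⟩ : ∃ j, j ≤ D ∧ altEigenvalue D j = (D : ℂ) - 2 * c ∧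
      (j = 1 ↔ c + 1 = D) := by
    rcases Nat.even_or_odd c with h | h
    · refine ⟨c, hc, by simp [altEigenvalue, h.neg_one_pow], ?_⟩
      obtain ⟨a, rfl⟩ := hD; obtain ⟨b, rfl⟩ := h
      omega
    · refine ⟨D - c, Nat.sub_le _ _, ?_, by omega⟩
      rw [altEigenvalue, (Nat.Even.sub_odd hc hD h).neg_one_pow, Nat.cast_sub hc]
      ring
  rw [← hje]
  split_ifs with h
  · obtain rfl := hj1.2 h
    exact Lagrange.eval_basis_self (altEigenvalue_injective hD).injOn (by simp; omega)
  · exact Lagrange.eval_basis_of_ne (fun e => h (hj1.1 e.symm)) (by simp; omega)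

/-- Expand the delta function at q in characters. F_1 keeps those of degree D - 1, and every
character is 1 at p. -/
theorem primitiveIdempotent_one (hD : Even D) (p q : Fin D → Bool) :
    2 ^ D * primitiveIdempotent (hypercube D) D (altEigenvalue D) 1 p q = dualEntry p q := by
  set F := primitiveIdempotent (hypercube D) D (altEigenvalue D) 1 with hF
  have h1 : (2 : ℂ) ^ D • Pi.single q (1 : ℂ)
      = ∑ t : Finset (Fin D), (∏ k ∈ t, sgn p k q) • fun s => ∏ k ∈ t, sgn p k s := by
    ext s
    rw [Finset.sum_apply]
    simp only [Pi.smul_apply, smul_eq_mul, sum_prod_sgn, Pi.single_apply, eq_comm (a := q)]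
    simp
  have h2 := congrArg (fun v => (F *ᵥ v) p) h1
  simp only [Matrix.mulVec_smul, Matrix.mulVec_single_one, Matrix.mulVec_sum] at h2
  rw [Pi.smul_apply, Matrix.col_apply, smul_eq_mul] at h2
  rw [h2, Finset.sum_apply, ← sum_prod_sgn_of_card]
  refine Finset.sum_congr rfl fun t _ => ?_
  have hcard : t.card ≤ D := by simpa using t.card_le_univ
  rw [hF, primitiveIdempotent, Matrix.aeval_mulVec_of_eigenvector (prod_sgn_eigenvector p t),
    eval_basis_one hD hcard]
  split_ifs <;> simp

theorem hypercubeB_eq (hD : Even D) (p : Fin D → Bool) :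
    hypercubeB D p = Matrix.diagonal (dualEntry p) := by
  rw [hypercubeB, dualAdjacency, dualDistanceMatrix]
  congr 1
  ext q
  rw [← primitiveIdempotent_one hD]
  simp

/-! ### Distance in the hypercube and stability under A and B -/

theorem parity_eq (p s : Fin D → Bool) : parity p s = (-1) ^ hammingDist p s := by
  simp only [parity, sgn, hammingDist, eq_comm (b := p _)]
  rw [Finset.prod_ite]
  simp

theorem sum_sgn_eq (p s : Fin D → Bool) :
    ∑ k, sgn p k s = (D : ℂ) - 2 * hammingDist p s := by
  have : ∀ k, sgn p k s = 1 - 2 * (if p k ≠ s k then 1 else 0) := by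
    intro k
    simp only [sgn, eq_comm (b := p _)]
    split_ifs <;> norm_num at *
    all_goals contradiction
  simp only [this, Finset.sum_sub_distrib, ← Finset.mul_sum, hammingDist, Finset.sum_boole]
  simp

theorem dualEntry_eq (p s : Fin D → Bool) :
    dualEntry p s = altEigenvalue D (hammingDist p s) := by
  rw [dualEntry, parity_eq, sum_sgn_eq, altEigenvalue]

theorem hammingDist_flip (s : Fin D → Bool) (k : Fin D) : hammingDist s (flip k s) = 1 := by
  rw [hammingDist, Finset.card_eq_one]
  refine ⟨k, ?_⟩
  ext j
  rw [Finset.mem_filter]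
  rcases eq_or_ne j k with rfl | h
  · simp [flip_apply_self]
  · simp [flip_apply_of_ne h, h]

theorem hammingDist_le_length {s t : Fin D → Bool} (w : (hypercube D).Walk s t) :
    hammingDist s t ≤ w.length := by
  induction w with
  | nil => simp
  | cons h w ih =>
    obtain ⟨k, rfl⟩ := adj_iff.1 h
    rename_i u v
    have h1 := hammingDist_triangle u (flip k u) v
    rw [hammingDist_flip] at h1
    rw [SimpleGraph.Walk.length_cons]
    omega

theorem exists_walk (n : ℕ) : ∀ s t : Fin D → Bool, hammingDist s t = n →
    ∃ w : (hypercube D).Walk s t, w.length = n := by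
  induction n with
  | zero =>
    intro s t h
    obtain rfl := hammingDist_eq_zero.1 h
    exact ⟨.nil, rfl⟩
  | succ n ih =>
    intro s t h
    obtain ⟨k, hk⟩ : ∃ k, s k ≠ t k := by
      by_contra! hall
      rw [funext hall, hammingDist_self] at h
      omega
    have h1 : hammingDist (flip k s) t = n := by
      have : (Finset.univ.filter fun j => flip k s j ≠ t j)
          = (Finset.univ.filter fun j => s j ≠ t j).erase k := by
        ext j
        rw [Finset.mem_erase, Finset.mem_filter, Finset.mem_filter]
        rcases eq_or_ne j k with rfl | hj
        · rw [flip_apply_self]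
          simpa using hk
        · simp [flip_apply_of_ne hj, hj]
      rw [hammingDist, this, Finset.card_erase_of_mem (by simpa using hk)]
      rw [hammingDist] at h
      omega
    obtain ⟨w, hw⟩ := ih _ _ h1
    exact ⟨.cons (adj_iff.2 ⟨k, rfl⟩) w, by simp [hw]⟩

theorem dist_eq (s t : Fin D → Bool) : (hypercube D).dist s t = hammingDist s t := by
  obtain ⟨w, hw⟩ := exists_walk _ s t rfl
  refine le_antisymm (hw ▸ SimpleGraph.dist_le w) ?_
  obtain ⟨w', hw'⟩ := w.reachable.exists_walk_length_eq_dist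
  exact hw' ▸ hammingDist_le_length w'

theorem dualIdempotent_mulVec (p : Fin D → Bool) (i : ℕ) (w : (Fin D → Bool) → ℂ)
    (s : Fin D → Bool) :
    (dualIdempotent (hypercube D) p i *ᵥ w) s = if hammingDist p s = i then w s else 0 := by
  rw [dualIdempotent, Matrix.mulVec_diagonal, dist_eq]
  simp

/-- B is the sum of the θ_i E*_i; conversely each E*_i with i ≤ D is a Lagrange polynomial in B, and
E*_i = 0 for i > D. -/
theorem isTModule_iff (hD : Even D) (p : Fin D → Bool) (W : Submodule ℂ ((Fin D → Bool) → ℂ)) :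
    IsTModule (hypercube D) p W ↔ (∀ w ∈ W, adjacency (hypercube D) *ᵥ w ∈ W) ∧
      ∀ w ∈ W, hypercubeB D p *ᵥ w ∈ W := by
  have hle (s : Fin D → Bool) : hammingDist p s ≤ D := by
    simpa using hammingDist_le_card_fintype (x := p) (y := s)
  rw [_root_.isTModule_iff, hypercubeB_eq hD]
  refine and_congr_right fun _ => ⟨fun h w hw => ?_, fun h i w hw => ?_⟩
  · have : Matrix.diagonal (dualEntry p) *ᵥ w = ∑ i ∈ Finset.range (D + 1),
        altEigenvalue D i • dualIdempotent (hypercube D) p i *ᵥ w := by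
      ext s
      rw [Matrix.mulVec_diagonal, dualEntry_eq, Finset.sum_apply]
      simp only [Pi.smul_apply, dualIdempotent_mulVec, smul_eq_mul, mul_ite, mul_zero]
      rw [Finset.sum_ite_eq, if_pos (Finset.mem_range_succ_iff.2 (hle s))]
    rw [this]
    exact W.sum_mem fun i _ => W.smul_mem _ (h i w hw)
  · by_cases hi : i ≤ D
    · have := Matrix.aeval_mulVec_mem h
        (Lagrange.basis (Finset.range (D + 1)) (altEigenvalue D) i) w hw
      convert this using 1
      ext s
      rw [dualIdempotent_mulVec, Matrix.aeval_diagonal, Matrix.mulVec_diagonal, dualEntry_eq]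
      split_ifs with hs
      · rw [hs, Lagrange.eval_basis_self (altEigenvalue_injective hD).injOn (Finset.mem_range_succ_iff.2 hi),
          one_mul]
      · rw [Lagrange.eval_basis_of_ne (Ne.symm hs) (Finset.mem_range_succ_iff.2 (hle s)),
          zero_mul]
    · convert W.zero_mem using 1
      ext s
      rw [dualIdempotent_mulVec, if_neg (by have := hle s; omega)]
      rfl

end Hypercube

/-! ### Existence and uniqueness of module structures -/

namespace ACSA

variable {K : Type*} [Field K] {R : Type*} [Ring R] [Algebra K R]

/-- The algebra homomorphism determined by three elements satisfying the defining relations. -/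
def lift {X Y Z : R} (h : IsSpinTriple X Y Z) : ACSA K →ₐ[K] R :=
  RingQuot.liftAlgHom K ⟨FreeAlgebra.lift K fun g => match g with | .x => X | .y => Y | .z => Z, by
    intro a b hab
    cases hab with
    | xy => simpa [map_ofNat] using h.xy
    | yz => simpa [map_ofNat] using h.yz
    | zx => simpa [map_ofNat] using h.zx⟩

theorem lift_x {X Y Z : R} (h : IsSpinTriple X Y Z) : lift (K := K) h (gen K .x) = X := by
  simp [lift, gen]

theorem lift_y {X Y Z : R} (h : IsSpinTriple X Y Z) : lift (K := K) h (gen K .y) = Y := by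
  simp [lift, gen]

/-- A module structure is determined by the actions of `x` and `y`. -/
theorem module_ext [CharZero K] {M : Type*} [AddCommGroup M] [Module K M]
    (P Q : Module (ACSA K) M)
    (hP : letI := P; IsScalarTower K (ACSA K) M) (hQ : letI := Q; IsScalarTower K (ACSA K) M)
    (hx : ∀ v : M, (letI := P; gen K .x • v) = (letI := Q; gen K .x • v))
    (hy : ∀ v : M, (letI := P; gen K .y • v) = (letI := Q; gen K .y • v)) : P = Q := by
  refine Module.ext' P Q fun a => ?_
  refine ACSA.induction
    (C := fun a => ∀ v : M, (letI := P; a • v) = (letI := Q; a • v)) ?_ ?_ ?_ ?_ a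
  · intro c v
    have h1 : (letI := P; algebraMap K (ACSA K) c • v) = c • v := by
      let _ := P; exact algebraMap_smul (ACSA K) c v
    exact h1.trans (algebraMap_smul (ACSA K) c v).symm
  · intro g v
    cases g with
    | x => exact hx v
    | y => exact hy v
    | z =>
      refine (@smul_z K _ M _ _ P _ v).trans (Eq.trans ?_ (@smul_z K _ M _ _ Q _ v).symm)
      rw [hx v, hx, hy v, hy]
  · intro a b ha hb v
    have h1 : (letI := P; (a * b) • v) = (letI := P; a • b • v) := by
      let _ := P; exact mul_smul a b v
    rw [h1, mul_smul a b v, hb v]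
    exact ha _
  · intro a b ha hb v
    refine (@add_smul _ _ _ _ P a b v).trans (Eq.trans ?_ (@add_smul _ _ _ _ Q a b v).symm)
    exact congrArg₂ _ (ha v) (hb v)

end ACSA

/-! ### The action on the standard module and the endpoint vector -/

namespace Hypercube

variable {D : ℕ}

/-- The operator by which `z` acts on the standard module. -/
def opZ (p : Fin D → Bool) : Module.End ℂ ((Fin D → Bool) → ℂ) where
  toFun f s := ∑ k, parity p s * sgn p k s * f (flip k s)
  map_add' f g := by ext s; simp [mul_add, Finset.sum_add_distrib]
  map_smul' c f := by
    ext s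
    simp only [Pi.smul_apply, smul_eq_mul, RingHom.id_apply, Finset.mul_sum]
    exact Finset.sum_congr rfl fun k _ => by ring

theorem opZ_apply (p : Fin D → Bool) (f : (Fin D → Bool) → ℂ) (s : Fin D → Bool) :
    opZ p f s = ∑ k, parity p s * sgn p k s * f (flip k s) := rfl

theorem isSpinTriple (hD : Even D) (p : Fin D → Bool) :
    IsSpinTriple (Matrix.toLin' (adjacency (hypercube D))) (Matrix.toLin' (hypercubeB D p))
      (opZ p) where
  xy := by
    refine LinearMap.ext fun f => funext fun s => ?_
    simp only [two_mul, LinearMap.add_apply, Module.End.mul_apply, Matrix.toLin'_apply,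
      hypercubeB_eq hD, Pi.add_apply, adjacency_mulVec, Matrix.mulVec_diagonal, opZ_apply,
      Finset.mul_sum, ← Finset.sum_add_distrib, dualEntry_flip]
    exact Finset.sum_congr rfl fun k _ => by ring
  yz := by
    refine LinearMap.ext fun f => funext fun s => ?_
    simp only [two_mul, LinearMap.add_apply, Module.End.mul_apply, Matrix.toLin'_apply,
      hypercubeB_eq hD, Pi.add_apply, adjacency_mulVec, Matrix.mulVec_diagonal, opZ_apply,
      Finset.mul_sum, ← Finset.sum_add_distrib, dualEntry_flip]
    refine Finset.sum_congr rfl fun k _ => ?_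
    linear_combination (2 * f (flip k s) * (sgn p k s * sgn p k s)) * parity_mul_self p s
      + 2 * f (flip k s) * sgn_mul_self p k s
  zx := by
    refine LinearMap.ext fun f => funext fun s => ?_
    simp only [two_mul, LinearMap.add_apply, Module.End.mul_apply, Matrix.toLin'_apply,
      hypercubeB_eq hD, Pi.add_apply, adjacency_mulVec, Matrix.mulVec_diagonal, opZ_apply,
      Finset.mul_sum, parity_flip]
    have h1 (j k : Fin D) : sgn p j (flip k s) = sgn p j s - if j = k then 2 * sgn p k s else 0 := by
      split_ifs with h
      · rw [h, sgn_flip_self]; ring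
      · rw [sgn_flip_of_ne p h, sub_zero]
    -- Flips commute, so the two double sums cancel; only the terms that flip one coordinate twice
    -- survive, and they give 2B.
    have h2 : ∑ k, ∑ j, parity p s * sgn p j s * f (flip j (flip k s))
        = ∑ k, ∑ j, parity p s * sgn p k s * f (flip j (flip k s)) := by
      rw [Finset.sum_comm]
      simp only [flip_comm]
    simp only [h1, mul_sub, sub_mul, Finset.sum_sub_distrib, mul_ite, ite_mul, mul_zero, zero_mul,
      Finset.sum_ite_eq', Finset.mem_univ, if_true, flip_flip, neg_mul, Finset.sum_neg_distrib,
      dualEntry, Finset.mul_sum, Finset.sum_mul, sub_neg_eq_add]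
    have h3 := sub_eq_zero.2 h2.symm
    rw [← Finset.sum_sub_distrib] at h3
    rw [← sub_eq_zero, ← h3]
    simp only [← Finset.sum_add_distrib, ← Finset.sum_sub_distrib]
    refine Finset.sum_congr rfl fun k _ => ?_
    simp only [Finset.sum_sub_distrib]
    ring

theorem existsUnique_structure (hD : Even D) (p : Fin D → Bool) :
    ∃! inst : Module (ACSA ℂ) ((Fin D → Bool) → ℂ), IsABStructure D p inst := by
  let φ := ACSA.lift (K := ℂ) (isSpinTriple hD p)
  refine ⟨Module.compHom _ φ.toRingHom, ⟨?_, fun v => ⟨?_, ?_⟩⟩, ?_⟩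
  · let _ := Module.compHom ((Fin D → Bool) → ℂ) φ.toRingHom
    refine ⟨fun c a v => ?_⟩
    change φ (c • a) v = c • φ a v
    rw [map_smul, LinearMap.smul_apply]
  · change φ (ACSA.gen ℂ .x) v = _
    rw [ACSA.lift_x, Matrix.toLin'_apply]
  · change φ (ACSA.gen ℂ .y) v = _
    rw [ACSA.lift_y, Matrix.toLin'_apply]
  · intro Q hQ
    refine ACSA.module_ext Q _ hQ.1 ?_ (fun v => ?_) (fun v => ?_)
    · let _ := Module.compHom ((Fin D → Bool) → ℂ) φ.toRingHom
      refine ⟨fun c a v => ?_⟩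
      change φ (c • a) v = c • φ a v
      rw [map_smul, LinearMap.smul_apply]
    · change _ = φ (ACSA.gen ℂ .x) v
      rw [ACSA.lift_x, Matrix.toLin'_apply]
      exact (hQ.2 v).1
    · change _ = φ (ACSA.gen ℂ .y) v
      rw [ACSA.lift_y, Matrix.toLin'_apply]
      exact (hQ.2 v).2

theorem hammingDist_flip_right (p s : Fin D → Bool) (k : Fin D) :
    (hammingDist p (flip k s) : ℂ) = hammingDist p s + sgn p k s := by
  have := sum_sgn_flip p k s
  rw [sum_sgn_eq, sum_sgn_eq] at this
  linear_combination (-1 / 2 : ℂ) * this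

/-- A vector supported at distance `r` from `p`, and sent by `A` to a vector that vanishes at
distance `r - 1`, is killed by `A - (-1)^r Z`. -/
theorem adjacency_mulVec_eq_opZ (p : Fin D → Bool) {r : ℕ} {w : (Fin D → Bool) → ℂ}
    (hw : ∀ s, hammingDist p s ≠ r → w s = 0)
    (hA : ∀ s, hammingDist p s + 1 = r → (adjacency (hypercube D) *ᵥ w) s = 0) :
    adjacency (hypercube D) *ᵥ w = (-1 : ℂ) ^ r • opZ p w := by
  ext s
  -- Where w is nonzero at the flipped vertex, s has parity opposite to r.
  have h1 (k : Fin D) : (-1 : ℂ) ^ r * (parity p s * sgn p k s * w (flip k s))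
      = -(sgn p k s * w (flip k s)) := by
    by_cases h : hammingDist p (flip k s) = r
    · have h2 := parity_flip p k s
      have h3 := parity_mul_self p s
      rw [parity_eq, h] at h2
      rw [h2]
      linear_combination (-(sgn p k s * w (flip k s))) * h3
    · simp [hw _ h]
  rw [Pi.smul_apply, opZ_apply, smul_eq_mul, Finset.mul_sum, Finset.sum_congr rfl fun k _ => h1 k]
  -- At distance r - 1 only flips of sign +1 reach the support, and both sides vanish by `hA`.
  -- Elsewhere only flips of sign -1 can reach it, and the two sides agree term by term.
  by_cases hs : hammingDist p s + 1 = r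
  · have h2 (k : Fin D) : sgn p k s * w (flip k s) = w (flip k s) := by
      by_cases h : s k = p k
      · simp [sgn, h]
      · have h3 := hammingDist_flip_right p s k
        rw [sgn, if_neg h] at h3
        rw [hw, mul_zero]
        intro h4
        rw [h4, ← hs] at h3
        push_cast at h3
        have : (2 : ℂ) = 0 := by linear_combination h3
        norm_num at this
    rw [Finset.sum_neg_distrib, Finset.sum_congr rfl fun k _ => h2 k, ← adjacency_mulVec, hA s hs,
      neg_zero]
  · rw [adjacency_mulVec]
    refine Finset.sum_congr rfl fun k _ => ?_
    by_cases h : s k = p k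
    · have h3 := hammingDist_flip_right p s k
      rw [sgn, if_pos h] at h3
      rw [hw, mul_zero, neg_zero]
      intro h4
      rw [h4] at h3
      exact hs (by exact_mod_cast h3.symm)
    · simp [sgn, h]

theorem exists_endpoint_vector (hD : Even D) {p : Fin D → Bool}
    {W : Submodule ℂ ((Fin D → Bool) → ℂ)} {r : ℕ} (hW : IsTModule (hypercube D) p W)
    (hr : IsEndpoint (hypercube D) p W r) :
    ∃ w ∈ W, w ≠ 0 ∧ hypercubeB D p *ᵥ w = ((-1 : ℂ) ^ r * ((D : ℂ) - 2 * r)) • w ∧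
      adjacency (hypercube D) *ᵥ w = (-1 : ℂ) ^ r • opZ p w := by
  obtain ⟨hA, hE⟩ := (_root_.isTModule_iff _ p W).1 hW
  obtain ⟨⟨w, hw, hne⟩, hmin⟩ := hr
  have hsupp : ∀ s, hammingDist p s ≠ r → (dualIdempotent (hypercube D) p r *ᵥ w) s = 0 := by
    intro s hs
    rw [dualIdempotent_mulVec, if_neg hs]
  refine ⟨_, hE r w hw, hne, ?_, adjacency_mulVec_eq_opZ p hsupp ?_⟩
  · ext s
    rw [hypercubeB_eq hD, Matrix.mulVec_diagonal, dualEntry_eq, Pi.smul_apply, smul_eq_mul]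
    by_cases hs : hammingDist p s = r
    · rw [hs, altEigenvalue]
    · rw [hsupp s hs, mul_zero, mul_zero]
  · intro s hs
    by_contra h
    -- A nonzero value at s would exhibit a vector of W with a component below the endpoint.
    have : r ≤ hammingDist p s := by
      refine hmin ⟨_, hA _ (hE r w hw), fun h0 => h ?_⟩
      have := congrFun h0 s
      rwa [dualIdempotent_mulVec, if_pos rfl] at this
    omega

end Hypercube

/-! ### The main theorem -/

open Hypercube in
theorem theoremT (D : ℕ) (hD : Even D) (p : Fin D → Bool) :
    (∃! inst : Module (ACSA ℂ) ((Fin D → Bool) → ℂ), IsABStructure D p inst) ∧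
    ∀ (inst : Module (ACSA ℂ) ((Fin D → Bool) → ℂ))
      [IsScalarTower ℂ (ACSA ℂ) ((Fin D → Bool) → ℂ)], IsABStructure D p inst →
      ∀ (W : Submodule ℂ ((Fin D → Bool) → ℂ)) (r : ℕ),
        IsIrreducibleTModule (hypercube D) p W → IsEndpoint (hypercube D) p W r →
        2 * r ≤ D ∧
        ∃ U : Submodule (ACSA ℂ) ((Fin D → Bool) → ℂ),
          (U : Set ((Fin D → Bool) → ℂ)) = (W : Set ((Fin D → Bool) → ℂ)) ∧
          IsSimpleModule (ACSA ℂ) U ∧ ACSA.HasTypeB ℂ (D - 2 * r) U := by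
  refine ⟨existsUnique_structure hD p, ?_⟩
  intro inst _ hinst W r hW hr
  obtain ⟨hWT, hW0, hWmin⟩ := hW
  obtain ⟨hA, hB⟩ := (Hypercube.isTModule_iff hD p W).1 hWT
  have hstable := ACSA.stable_of_xy (S := W) (fun v hv => by rw [(hinst.2 v).1]; exact hA v hv)
    (fun v hv => by rw [(hinst.2 v).2]; exact hB v hv)
  let U := ACSA.submoduleOfStable W hstable
  have hU : ∀ v, v ∈ U ↔ v ∈ W := fun v => Iff.rfl
  have hsimple : IsSimpleModule (ACSA ℂ) U := by
    rw [isSimpleModule_iff_isAtom]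
    refine ⟨fun h => hW0 ?_, fun N hN => ?_⟩
    · rw [eq_bot_iff]
      intro v hv
      have : v ∈ U := hv
      rw [h] at this
      exact this
    -- Stability under x and y is stability under T, so irreducibility of W applies to N.
    · have hNT : IsTModule (hypercube D) p (N.restrictScalars ℂ) := by
        rw [Hypercube.isTModule_iff hD]
        refine ⟨fun v hv => ?_, fun v hv => ?_⟩
        · rw [← (hinst.2 v).1]; exact N.smul_mem _ hv
        · rw [← (hinst.2 v).2]; exact N.smul_mem _ hv
      rcases hWmin _ hNT (fun v hv => hN.le hv) with h | h
      · exact (Submodule.restrictScalars_eq_bot_iff ..).1 h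
      · refine absurd (fun v hv => ?_) (not_le_of_gt hN)
        change v ∈ N.restrictScalars ℂ
        rw [h]
        exact hv
  obtain ⟨w, hw, hne, hy, hx⟩ := exists_endpoint_vector hD hWT hr
  have hz : ACSA.gen ℂ .z • w = opZ p w := by
    have h := congrArg (fun f : Module.End ℂ _ => f w) (isSpinTriple hD p).xy
    simp only [two_mul, LinearMap.add_apply, Module.End.mul_apply, Matrix.toLin'_apply] at h
    rw [ACSA.smul_z, (hinst.2 w).1, (hinst.2 w).2, (hinst.2 _).1, (hinst.2 _).2, h, ← two_smul ℂ,
      inv_smul_smul₀ two_ne_zero]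
  have : FiniteDimensional ℂ U := inferInstanceAs (FiniteDimensional ℂ W)
  obtain ⟨n, hn, hT⟩ := ACSA.exists_hasTypeB (K := ℂ) (M := U) (m := ⟨w, hw⟩)
    (fun h => hne (congrArg Subtype.val h)) (neg_one_pow_eq_or ℂ r) (d := (D : ℤ) - 2 * r)
    (Even.sub (by exact_mod_cast hD) (even_two_mul _))
    (Subtype.ext (by
      change ACSA.gen ℂ .y • w = _ • w
      rw [(hinst.2 w).2, hy]
      push_cast
      rfl))
    (Subtype.ext (by
      change ACSA.gen ℂ .x • w = _ • ACSA.gen ℂ .z • w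
      rw [hz, (hinst.2 w).1, hx]))
  -- The integer D - 2r equals the natural number n; this gives the bound and makes the truncated
  -- subtraction exact.
  refine ⟨by omega, U, rfl, hsimple, ?_⟩
  obtain rfl : n = D - 2 * r := by omega
  exact hT

end
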